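/- \textbf{Notation.} For $r\ge 1$, $\mathbf k=(k_1,\dots,k_r)\in\mathbb Z^r$ and $0<t<1$ let $$\mathrm{Li}_{\mathbf k}(t)=\sum_{0<n_1<\cdots<n_r}\frac{t^{n_r}}{n_1^{k_1}\cdots n_r^{k_r}},$$ let $J[f](t)=\int_0^t f(z)\,\frac{dz}{z}$ and $D[f](t)=t\,f'(t)$, and let $J^{n}$ be the $n$-fold iterate of $J$ for $n\ge 0$ and the $(-n)$-fold iterate of $D$ for $n<0$. Put $$L^{\mathrm{des}}(0)(t)=\mathrm{Li}_0(t)+\log t\cdot \mathrm{Li}_{-1}(t),$$ $$L^{\mathrm{des}}(\mathbf k)(t)=J^{k_r}\Bigl[L^{\mathrm{des}}(0)\,J^{k_{r-1}}\bigl[L^{\mathrm{des}}(0)\cdots J^{k_1}[L^{\mathrm{des}}(0)]\cdots\bigr]\Bigr](t).$$ Let $$\mathcal G_r=\prod_{j=1}^{r}\bigl\{1-(u_jv_j+\cdots+u_rv_r)(v_j^{-1}-v_{j-1}^{-1})\bigr\},\qquad v_0^{-1}:=0,$$ and for $q\ge0$ define integers $a^r_{\mathbf l,\mathbf m}(q)$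 by $$\Bigl(v_r^{-1}\frac{\partial}{\partial u_r}\Bigr)^{q}\mathcal G_r=\sum_{\substack{\mathbf l\in\mathbb Z_{\ge0}^r,\ \mathbf m\in\mathbb Z^r\\ m_1+\cdots+m_r=-q}}a^r_{\mathbf l,\mathbf m}(q)\prod_{j=1}^{r}u_j^{l_j}v_j^{m_j}.$$ Write $(s)_l=s(s+1)\cdots(s+l-1)$ with $(s)_0=1$, and $\mathbf k^{(j)}=(k_1,\dots,k_{r-1},k_r-j)$. Put $$Z_0(\mathbf k;t)=\sum_{\substack{\mathbf l\in\mathbb Z_{\ge0}^r,\ \mathbf m\in\mathbb Z^r\\ m_1+\cdots+m_r=0}}a^r_{\mathbf l,\mathbf m}(0)\Bigl(\prod_{j=1}^r(k_j)_{l_j}\Bigr)\mathrm{Li}_{\mathbf k+\mathbf m}(t),$$ $$Z_q(\mathbf k;t)=\sum_{i+j=q}(-1)^j\binom{q}{i}D^i\bigl[Z_0(\mathbf k^{(j)};\cdot)\bigr](t)\quad(q\ge0),\qquad Z(\mathbf k;t)=\sum_{q\ge0}\frac{(-\log t)^q}{q!}\,Z_q(\mathbf k;t).$$ \textbf{Theorem.}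 For all $r\ge1$, $\mathbf k\in\mathbb Z^r$ and $0<t<1$, the series $\mathrm{Li}_{\mathbf k}(t)$ converges absolutely, $L^{\mathrm{des}}(\mathbf k)$ is differentiable at $t$ and $L^{\mathrm{des}}(\mathbf k)(z)/z$ is integrable on $(0,t)$ (so that all the operators above are well defined), $Z_q(\mathbf k;t)=0$ for $q>r$, and $$L^{\mathrm{des}}(\mathbf k)(t)=Z(\mathbf k;t).$$ Moreover, for $0\le q\le r$, $$Z_q(\mathbf k;t)=\sum_{\substack{\mathbf l\in\mathbb Z_{\ge0}^r,\ \mathbf m\in\mathbb Z^r\\ m_1+\cdots+m_r=-q}}a^r_{\mathbf l,\mathbf m}(q)\Bigl(\prod_{j=1}^r(k_j)_{l_j}\Bigr)\mathrm{Li}_{\mathbf k+\mathbf m}(t),$$ so that explicitly $$L^{\mathrm{des}}(\mathbf k)(t)=\sum_{q=0}^{r}(-1)^q\frac{(\log t)^q}{q!}\sum_{\substack{\mathbf l\in\mathbb Z_{\ge0}^r,\ \mathbf m\in\mathbb Z^r\\ m_1+\cdots+m_r=-q}}a^r_{\mathbf l,\mathbf m}(q)\Bigl(\prod_{j=1}^r(k_j)_{l_j}\Bigr)\mathrm{Li}_{\mathbf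 k+\mathbf m}(t).$$ -/

import Mathlib

/-! Multi-indices of depth `r + 1` (so every depth `≥ 1`) are functions `Fin (r + 1) → ℤ`; the last
entry is the value at `Fin.last r`. -/

namespace DesLi

noncomputable section

/-- The summation range of a multiple polylogarithm: tuples `0 < n_1 < ⋯ < n_{r+1}`. -/
abbrev IncTuple (r : ℕ) : Type :=
  {n : Fin (r + 1) → ℕ // StrictMono n ∧ ∀ i, 0 < n i}

/-- The general term `t ^ n_{r+1} / (n_1 ^ k_1 ⋯ n_{r+1} ^ k_{r+1})`. -/
def LiTerm {r : ℕ} (k : Fin (r + 1) → ℤ) (t : ℝ) (n : IncTuple r) : ℝ :=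
  t ^ n.1 (Fin.last r) / ∏ i, (n.1 i : ℝ) ^ k i

/-- The multiple polylogarithm `Li_k(t)`. -/
def Li {r : ℕ} (k : Fin (r + 1) → ℤ) (t : ℝ) : ℝ :=
  ∑' n : IncTuple r, LiTerm k t n

/-- `J[f](t) = ∫_0^t f(z) dz / z`. -/
def J (f : ℝ → ℝ) : ℝ → ℝ := fun t => ∫ z in (0 : ℝ)..t, f z / z

/-- `D[f](t) = t f'(t)`. -/
def D (f : ℝ → ℝ) : ℝ → ℝ := fun t => t * deriv f t

/-- `J^n` for an integer `n`, where negative powers are powers of `D = J⁻¹`. -/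
def Jpow : ℤ → (ℝ → ℝ) → (ℝ → ℝ)
  | Int.ofNat n => J^[n]
  | Int.negSucc n => D^[n + 1]

/-- `L(0)(t) = Li_0(t) + log t * Li_{-1}(t)`. -/
def desLi0 (t : ℝ) : ℝ := Li ![0] t + Real.log t * Li ![-1] t

/-- `L(k_1, …, k_r) = J^{k_r}[L(0) ⋅ J^{k_{r-1}}[L(0) ⋯ J^{k_1}[L(0)] ⋯ ]]`. -/
def desLi : {r : ℕ} → (Fin (r + 1) → ℤ) → ℝ → ℝ
  | 0, k => Jpow (k 0) desLi0
  | r + 1, k => Jpow (k (Fin.last (r + 1))) (fun t => desLi0 t * desLi (Fin.init k) t)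

/-- Laurent polynomials over `ℤ` in the variables `v_1, …, v_{r+1}`. -/
abbrev Laurent (r : ℕ) : Type := AddMonoidAlgebra ℤ (Fin (r + 1) → ℤ)

/-- Polynomials in `u_1, …, u_{r+1}` with coefficients Laurent polynomials in `v_1, …, v_{r+1}`. -/
abbrev UV (r : ℕ) : Type := MvPolynomial (Fin (r + 1)) (Laurent r)

/-- The element `v_j ^ n`. -/
def vpow {r : ℕ} (j : Fin (r + 1)) (n : ℤ) : UV r :=
  MvPolynomial.C (AddMonoidAlgebra.single (Pi.single j n) 1)

/-- The element `v_{j-1}⁻¹`, with the convention `v_0⁻¹ = 0`. -/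
def vinvPrev {r : ℕ} (j : Fin (r + 1)) : UV r :=
  Fin.cases (motive := fun _ => UV r) 0 (fun i => vpow i.castSucc (-1)) j

/-- `𝒢 = ∏_j (1 - (u_j v_j + ⋯ + u_{r+1} v_{r+1}) (v_j⁻¹ - v_{j-1}⁻¹))`. -/
def G (r : ℕ) : UV r :=
  ∏ j : Fin (r + 1),
    (1 - (∑ i ∈ Finset.Ici j, MvPolynomial.X i * vpow i 1) * (vpow j (-1) - vinvPrev j))

/-- The operator `v_{r+1}⁻¹ ∂/∂u_{r+1}`. -/
def vDu {r : ℕ} (P : UV r) : UV r :=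
  vpow (Fin.last r) (-1) * MvPolynomial.pderiv (Fin.last r) P

/-- `(v_{r+1}⁻¹ ∂/∂u_{r+1})^q [𝒢]`. -/
def Gq (r q : ℕ) : UV r := vDu^[q] (G r)

/-- The coefficient `a_{l,m}(q)` of `∏_j u_j^{l_j} v_j^{m_j}` in `(v_{r+1}⁻¹ ∂/∂u_{r+1})^q [𝒢]`. -/
def a {r : ℕ} (q : ℕ) (l : Fin (r + 1) →₀ ℕ) (m : Fin (r + 1) → ℤ) : ℤ :=
  ((Gq r q).coeff l).coeff m

/-- The Pochhammer symbol `(s)_l = s (s + 1) ⋯ (s + l - 1)`. -/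
def poch (s : ℤ) (l : ℕ) : ℤ := (ascPochhammer ℤ l).eval s

/-- `∑_{l, m, |m| = -q} a_{l,m}(q) (∏_j (k_j)_{l_j}) Li_{k+m}(t)`; the sum runs over the finitely
many `(l, m)` with `a_{l,m}(q) ≠ 0`. -/
def polylogComb {r : ℕ} (q : ℕ) (k : Fin (r + 1) → ℤ) (t : ℝ) : ℝ :=
  ∑ l ∈ (Gq r q).support,
    ∑ m ∈ ((Gq r q).coeff l).coeff.support with ∑ j, m j = -(q : ℤ),
      (a q l m : ℝ) * (∏ j, (poch (k j) (l j) : ℝ)) * Li (k + m) t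

/-- `Z_0(k; t)`, with the coefficients `a_{l,m} = a_{l,m}(0)` of `𝒢`. -/
def Z0 {r : ℕ} (k : Fin (r + 1) → ℤ) (t : ℝ) : ℝ := polylogComb 0 k t

/-- `k^{(j)}`: the last entry of `k` lowered by `j`. -/
def lowerLast {r : ℕ} (k : Fin (r + 1) → ℤ) (j : ℤ) : Fin (r + 1) → ℤ :=
  Function.update k (Fin.last r) (k (Fin.last r) - j)

/-- `Z_q(k; t) = ∑_{i+j=q} (-1)^j (q choose i) D^i[Z_0(k^{(j)})]`. -/
def Zq {r : ℕ} (q : ℕ) (k : Fin (r + 1) → ℤ) (t : ℝ) : ℝ :=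
  ∑ p ∈ Finset.HasAntidiagonal.antidiagonal q,
    (-1 : ℝ) ^ p.2 * (q.choose p.1 : ℝ) * (D^[p.1] (Z0 (lowerLast k p.2))) t

/-- `Z(k; t) = ∑_{q ≥ 0} (-log t)^q / q! * Z_q(k; t)`, a sum with finitely many nonzero terms. -/
def Z {r : ℕ} (k : Fin (r + 1) → ℤ) (t : ℝ) : ℝ :=
  ∑ᶠ q : ℕ, (-Real.log t) ^ q / (q.factorial : ℝ) * Zq q k t

end

end DesLi

/-! Formally `(k)_l n^{-k-l} = Γ(k)⁻¹ ∫_0^∞ y^{k+l-1} e^{-ny} dy`, so `mellin` is a Mellin transform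
made algebraic, and hence available for every integer `k`. The substitution `v_j = 1/n_j`, `u_j =
n_j y_j` turns `𝒢` into `gPoly n` and the operator `vDu` into the derivative in the last `y`. Thus
the contribution of a tuple `n` to the `q`-th polylogarithm combination is the transform of the
`q`-th derivative of `gPoly n` (`zCoeff_eq_sum`). By Taylor's formula, summing against `(-log t)^q /
q!` replaces the last variable `y` by `y - log t`. The resulting function is `desSum`, and it obeys
the recursion that defines `desLi`.

Operator `D`: integration by parts for the transform (`mellin_pderiv`) gives `D[desSum k] = desSum
(lowerLast k 1)`, the derivatives of the powers of `log t` cancelling the extra terms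
(`hasDerivAt_desSum`). Since `desSum` tends to `0` at `0`, `J` inverts this (`J_eq_desSum`).

Multiplication by `desLi0`: if the last exponent is `0`, the transform sets the last variable to `0`
(`mellin_of_last_eq_zero`). Write `d` for the last gap `n_{r+2} - n_{r+1}`. By `gPoly_succ`, the
shifted polynomial then becomes the shifted polynomial of the shorter tuple times `1 + d log t`.
Summing `t^d (1 + d log t)` over `d ≥ 1` gives `desLi0` (`desSum_of_last_eq_zero`).

The formula for `Zq` is the recursion `zCoeff_succ` iterated by the binomial theorem. -/

namespace DesLi

noncomputable section

/-! ### The real polynomials to which `𝒢` specialises -/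

/-- The weight `(k)_l x^{-k-l}`. -/
def weight (k : ℤ) (x : ℝ) (l : ℕ) : ℝ := (poch k l : ℝ) * x ^ (-k - (l : ℤ))

lemma weight_zero (k : ℤ) (x : ℝ) : weight k x 0 = x ^ (-k) := by
  simp [weight, poch]

lemma poch_succ (k : ℤ) (l : ℕ) : poch k (l + 1) = poch k l * (k + l) := by
  simp [poch, ascPochhammer_succ_right]

lemma poch_pred_succ (k : ℤ) (l : ℕ) : poch (k - 1) (l + 1) = (k - 1) * poch k l := by
  simp [poch, ascPochhammer_succ_left]

lemma poch_zero_left (l : ℕ) : poch 0 l = if l = 0 then 1 else 0 := by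
  simp [poch, ascPochhammer_eval_zero]

/-- Integration by parts on the monomial `y^l`. At `l = 0` the truncated `l - 1` is harmless because
of the factor `l`. -/
lemma weight_rec (k : ℤ) {x : ℝ} (hx : x ≠ 0) (l : ℕ) :
    (l : ℝ) * weight k x (l - 1) = x * weight k x l - weight (k - 1) x l := by
  cases l with
  | zero =>
    simp only [weight_zero]
    rw [show -(k - 1) = 1 + -k by ring, zpow_add₀ hx]
    simp
  | succ l =>
    simp only [weight, Nat.add_sub_cancel]
    rw [poch_succ k, poch_pred_succ, show -(k - 1) - ((l + 1 : ℕ) : ℤ) = -k - (l : ℤ) by push_cast; ring,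
      show -k - (l : ℤ) = 1 + (-k - ((l + 1 : ℕ) : ℤ)) by push_cast; ring, zpow_add₀ hx,
      zpow_one]
    push_cast
    ring

lemma weight_zero_left (x : ℝ) (l : ℕ) : weight 0 x l = if l = 0 then 1 else 0 := by
  rw [weight, poch_zero_left]
  split_ifs with h <;> simp [h]

open MvPolynomial

/-- The linear functional `∏_j y_j^{l_j} ↦ ∏_j (k_j)_{l_j} n_j^{-k_j-l_j}`. -/
def mellin {r : ℕ} (k : Fin (r + 1) → ℤ) (n : Fin (r + 1) → ℕ) :
    MvPolynomial (Fin (r + 1)) ℝ →ₗ[ℝ] ℝ :=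
  (basisMonomials (Fin (r + 1)) ℝ).constr ℝ fun l => ∏ j, weight (k j) (n j) (l j)

variable {r : ℕ}

lemma mellin_monomial (k : Fin (r + 1) → ℤ) (n : Fin (r + 1) → ℕ) (l : Fin (r + 1) →₀ ℕ) (c : ℝ) :
    mellin k n (monomial l c) = c * ∏ j, weight (k j) (n j) (l j) := by
  have h : monomial l c = c • basisMonomials (Fin (r + 1)) ℝ l := by
    simp [coe_basisMonomials, smul_monomial]
  rw [h, map_smul, mellin, Module.Basis.constr_basis, smul_eq_mul]

lemma mellin_C_mul_prod (k : Fin (r + 1) → ℤ) (n : Fin (r + 1) → ℕ) (e : Fin (r + 1) → ℕ) (c : ℝ) :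
    mellin k n (C c * ∏ j, X j ^ e j) = c * ∏ j, weight (k j) (n j) (e j) := by
  have h := mellin_monomial k n (Finsupp.equivFunOnFinite.symm e) c
  rw [monomial_eq, Finsupp.prod_fintype _ _ (by simp)] at h
  simpa using h

lemma mellin_C_mul (k : Fin (r + 1) → ℤ) (n : Fin (r + 1) → ℕ) (c : ℝ)
    (P : MvPolynomial (Fin (r + 1)) ℝ) : mellin k n (C c * P) = c * mellin k n P := by
  rw [C_mul', map_smul, smul_eq_mul]

lemma mellin_pderiv (k : Fin (r + 1) → ℤ) (n : Fin (r + 1) → ℕ) (hn : n (Fin.last r) ≠ 0)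
    (P : MvPolynomial (Fin (r + 1)) ℝ) :
    mellin k n (pderiv (Fin.last r) P) =
      n (Fin.last r) * mellin k n P - mellin (lowerLast k 1) n P := by
  induction P using MvPolynomial.induction_on' with
  | monomial l c =>
    rw [pderiv_monomial, mellin_monomial, mellin_monomial, mellin_monomial]
    simp only [Fin.prod_univ_castSucc, lowerLast]
    have h := weight_rec (k (Fin.last r)) (x := n (Fin.last r)) (by exact_mod_cast hn)
      (l (Fin.last r))
    have h1 : ∀ i : Fin r, (l - Finsupp.single (Fin.last r) 1 : Fin (r + 1) →₀ ℕ) i.castSucc = l i.castSucc := by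
      intro i
      simp
    have h2 : (l - Finsupp.single (Fin.last r) 1 : Fin (r + 1) →₀ ℕ) (Fin.last r) =
        l (Fin.last r) - 1 := by simp
    have h3 : ∀ i : Fin r, Function.update k (Fin.last r) (k (Fin.last r) - 1) i.castSucc
        = k i.castSucc := fun i => Function.update_of_ne (Fin.castSucc_lt_last i).ne _ _
    simp only [h1, h2, h3, Function.update_self]
    linear_combination (c * ∏ i : Fin r, weight (k i.castSucc) (n i.castSucc) (l i.castSucc)) * h
  | add P Q hP hQ => simp only [map_add, hP, hQ]; ring

/-- Setting the last variable equal to zero. -/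
def killLast (r : ℕ) : MvPolynomial (Fin (r + 2)) ℝ →ₐ[ℝ] MvPolynomial (Fin (r + 1)) ℝ :=
  aeval (Fin.snoc (α := fun _ => MvPolynomial (Fin (r + 1)) ℝ) X 0)

/-- Since `(0)_l` vanishes for `l > 0`, only monomials free of the last variable survive on either
side. -/
lemma mellin_of_last_eq_zero (k : Fin (r + 2) → ℤ) (n : Fin (r + 2) → ℕ)
    (hk : k (Fin.last (r + 1)) = 0) (P : MvPolynomial (Fin (r + 2)) ℝ) :
    mellin k n P = mellin (Fin.init k) (Fin.init n) (killLast r P) := by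
  induction P using MvPolynomial.induction_on' with
  | monomial l c =>
    rw [mellin_monomial, killLast, aeval_monomial, Finsupp.prod_fintype _ _ (by simp),
      Fin.prod_univ_castSucc (n := r + 1), Fin.prod_univ_castSucc (n := r + 1), hk, weight_zero_left]
    simp only [Fin.snoc_castSucc, Fin.snoc_last, algebraMap_eq]
    split_ifs with h
    · rw [h, pow_zero, mul_one, mul_one,
        mellin_C_mul_prod _ _ (fun i : Fin (r + 1) => l i.castSucc)]
      rfl
    · simp [zero_pow h]
  | add P Q hP hQ => simp only [map_add, hP, hQ]

/-- The substitution `y_r ↦ y_r + y_{r+1}`. -/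
def splitLast (r : ℕ) : MvPolynomial (Fin (r + 1)) ℝ →ₐ[ℝ] MvPolynomial (Fin (r + 2)) ℝ :=
  aeval fun i => X i.castSucc + if i = Fin.last r then X (Fin.last (r + 1)) else 0

lemma killLast_splitLast (P : MvPolynomial (Fin (r + 1)) ℝ) : killLast r (splitLast r P) = P := by
  have h : (killLast r).comp (splitLast r) = AlgHom.id ℝ _ := by
    ext i : 1
    simp only [killLast, splitLast, AlgHom.comp_apply, aeval_X, map_add, Fin.snoc_castSucc]
    split_ifs <;> simp
  exact DFunLike.congr_fun h P

lemma pderiv_splitLast (P : MvPolynomial (Fin (r + 1)) ℝ) :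
    pderiv (Fin.last (r + 1)) (splitLast r P) = splitLast r (pderiv (Fin.last r) P) := by
  induction P using MvPolynomial.induction_on with
  | C c => simp [splitLast]
  | add P Q hP hQ => simp only [map_add, hP, hQ]
  | mul_X P i hP =>
    have h : pderiv (Fin.last (r + 1)) (splitLast r (X i)) =
        splitLast r (pderiv (Fin.last r) (X i)) := by
      have h0 : pderiv (Fin.last (r + 1)) (X i.castSucc : MvPolynomial (Fin (r + 2)) ℝ) = 0 :=
        pderiv_X_of_ne (Fin.castSucc_lt_last i).ne
      simp only [splitLast, aeval_X, map_add, h0, zero_add]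
      split_ifs with hi
      · subst hi; simp
      · rw [pderiv_X_of_ne hi]; simp
    simp only [map_mul, Derivation.leibniz, hP, h, smul_eq_mul, map_add]

/-- The difference `n_j - n_{j-1}`, with `n_0 = 0`. -/
def diffPrev (n : Fin (r + 1) → ℕ) (j : Fin (r + 1)) : ℝ :=
  n j - Fin.cases (motive := fun _ => ℝ) 0 (fun i => (n i.castSucc : ℝ)) j

/-- The polynomial `∏_j (1 - (y_j + ⋯ + y_{r+1}) (n_j - n_{j-1}))`. -/
def gPoly (n : Fin (r + 1) → ℕ) : MvPolynomial (Fin (r + 1)) ℝ :=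
  ∏ j, (1 - (∑ i ∈ Finset.Ici j, X i) * C (diffPrev n j))

lemma diffPrev_castSucc (n : Fin (r + 2) → ℕ) (j : Fin (r + 1)) :
    diffPrev n j.castSucc = diffPrev (Fin.init n) j := by
  induction j using Fin.cases with
  | zero => rfl
  | succ i => rfl

lemma diffPrev_last (n : Fin (r + 2) → ℕ) :
    diffPrev n (Fin.last (r + 1)) = n (Fin.last (r + 1)) - n (Fin.last r).castSucc := rfl

/-- Every tail sum of the shorter tuple contains its last variable exactly once, so `splitLast`
extends each of them by the new variable. -/
lemma gPoly_succ (n : Fin (r + 2) → ℕ) :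
    gPoly n = splitLast r (gPoly (Fin.init n)) *
      (1 - X (Fin.last (r + 1)) * C (diffPrev n (Fin.last (r + 1)))) := by
  rw [gPoly, Fin.prod_univ_castSucc, gPoly, map_prod]
  congr 1
  · refine Finset.prod_congr rfl fun j _ => ?_
    rw [diffPrev_castSucc, map_sub, map_one, map_mul, map_sum]
    have h : ∑ i ∈ Finset.Ici j.castSucc, (X i : MvPolynomial (Fin (r + 2)) ℝ) =
        ∑ i ∈ Finset.Ici j, splitLast r (X i) := by
      have e1 : Finset.Ici j.castSucc = Finset.univ.filter (fun i => j.castSucc ≤ i) := by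
        ext; simp
      have e2 : Finset.Ici j = Finset.univ.filter (fun i => j ≤ i) := by ext; simp
      simp only [splitLast, aeval_X, Finset.sum_add_distrib]
      rw [Finset.sum_ite_eq' (Finset.Ici j)]
      rw [e1, e2, Finset.sum_filter, Finset.sum_filter, Fin.sum_univ_castSucc]
      simp [Fin.le_last]
    rw [h]
    simp [splitLast, algebraMap_eq]
  · have h : Finset.Ici (Fin.last (r + 1)) = {Fin.last (r + 1)} := by
      ext i; simp [Fin.last_le_iff]
    rw [h, Finset.sum_singleton]

lemma gPoly_zero (n : Fin 1 → ℕ) : gPoly n = 1 - X 0 * C (n 0 : ℝ) := by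
  have h : Finset.Ici (0 : Fin 1) = {0} := by ext i; simp
  simp [gPoly, diffPrev, h]

/-- The `q`-th derivative of `gPoly n` in its last variable. -/
def gDeriv (q : ℕ) (n : Fin (r + 1) → ℕ) : MvPolynomial (Fin (r + 1)) ℝ :=
  (pderiv (Fin.last r))^[q] (gPoly n)

lemma gDeriv_succ (q : ℕ) (n : Fin (r + 1) → ℕ) :
    gDeriv (q + 1) n = pderiv (Fin.last r) (gDeriv q n) :=
  Function.iterate_succ_apply' _ _ _

/-- Leibniz rule for `gPoly_succ`: its second factor is linear in the last variable, so only two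
terms occur. -/
lemma gDeriv_rec (q : ℕ) (n : Fin (r + 2) → ℕ) :
    gDeriv q n = splitLast r (gDeriv q (Fin.init n)) *
        (1 - X (Fin.last (r + 1)) * C (diffPrev n (Fin.last (r + 1)))) -
      C (q : ℝ) * (splitLast r (gDeriv (q - 1) (Fin.init n)) *
        C (diffPrev n (Fin.last (r + 1)))) := by
  induction q with
  | zero => simp [gDeriv, gPoly_succ]
  | succ q ih =>
    rw [gDeriv_succ, ih]
    -- At `q = 0` the truncated `q - 1` gives a wrong derivative, but its coefficient `q` is zero.
    have h : (C (q : ℝ) : MvPolynomial (Fin (r + 2)) ℝ) *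
        splitLast r (pderiv (Fin.last r) (gDeriv (q - 1) (Fin.init n))) =
        C (q : ℝ) * splitLast r (gDeriv q (Fin.init n)) := by
      cases q with
      | zero => simp
      | succ q => rw [← gDeriv_succ]; rfl
    simp only [map_sub, Derivation.leibniz, smul_eq_mul, pderiv_C, pderiv_one, pderiv_X_self,
      pderiv_splitLast, ← gDeriv_succ, Nat.add_sub_cancel, Nat.cast_add, Nat.cast_one, C_add, C_1]
    rw [gDeriv_succ (q - 1)]
    linear_combination (-C (diffPrev n (Fin.last (r + 1)))) * h

lemma gDeriv_eq_zero (q : ℕ) (n : Fin (r + 1) → ℕ) (hq : r + 1 < q) : gDeriv q n = 0 := by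
  induction r generalizing q with
  | zero =>
    obtain ⟨q, rfl⟩ := Nat.exists_eq_add_of_le' (show 2 ≤ q by omega)
    rw [gDeriv, Function.iterate_add_apply]
    simp [gPoly_zero, Derivation.leibniz, iterate_map_zero]
  | succ r ih =>
    rw [gDeriv_rec, ih q _ (by omega), ih (q - 1) _ (by omega)]
    simp

/-- The coefficient of `t^{n_{r+1}}` in `Z_q(k; t)` belonging to the tuple `n`. -/
def zCoeff (q : ℕ) (k : Fin (r + 1) → ℤ) (n : Fin (r + 1) → ℕ) : ℝ := mellin k n (gDeriv q n)

lemma zCoeff_succ (q : ℕ) (k : Fin (r + 1) → ℤ) (n : Fin (r + 1) → ℕ) (hn : n (Fin.last r) ≠ 0) :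
    zCoeff (q + 1) k n = n (Fin.last r) * zCoeff q k n - zCoeff q (lowerLast k 1) n := by
  rw [zCoeff, gDeriv_succ, mellin_pderiv k n hn]
  rfl

lemma zCoeff_eq_zero (q : ℕ) (k : Fin (r + 1) → ℤ) (n : Fin (r + 1) → ℕ) (hq : r + 1 < q) :
    zCoeff q k n = 0 := by
  rw [zCoeff, gDeriv_eq_zero q n hq, map_zero]

lemma zCoeff_of_last_eq_zero (q : ℕ) (k : Fin (r + 2) → ℤ) (n : Fin (r + 2) → ℕ)
    (hk : k (Fin.last (r + 1)) = 0) :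
    zCoeff q k n = zCoeff q (Fin.init k) (Fin.init n) -
      q * diffPrev n (Fin.last (r + 1)) * zCoeff (q - 1) (Fin.init k) (Fin.init n) := by
  have h1 : ∀ c, killLast r (C c) = C c := fun c => by simp [killLast, algebraMap_eq]
  have h2 : killLast r (X (Fin.last (r + 1))) = 0 := by simp [killLast]
  rw [zCoeff, mellin_of_last_eq_zero k n hk, gDeriv_rec]
  simp only [map_sub, map_mul, map_one, killLast_splitLast, h1, h2, zero_mul, sub_zero, mul_one,
    mellin_C_mul]
  rw [mul_comm (gDeriv (q - 1) (Fin.init n)), mellin_C_mul, zCoeff, zCoeff]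
  ring

lemma zCoeff_depth_one (k : Fin 1 → ℤ) (hk : k 0 = 0) (n : Fin 1 → ℕ) :
    zCoeff 0 k n = 1 ∧ zCoeff 1 k n = -(n 0 : ℝ) := by
  have h1 : mellin k n (C 1) = 1 := by
    simpa [hk, weight_zero_left] using mellin_C_mul_prod k n 0 1
  have h2 : mellin k n (C (-(n 0 : ℝ))) = -(n 0 : ℝ) := by
    simpa [hk, weight_zero_left] using mellin_C_mul_prod k n 0 (-(n 0 : ℝ))
  have h3 : mellin k n (C (-(n 0 : ℝ)) * X 0) = 0 := by
    simpa [hk, weight_zero_left] using mellin_C_mul_prod k n 1 (-(n 0 : ℝ))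
  constructor
  · have : gDeriv 0 n = C 1 + C (-(n 0 : ℝ)) * X 0 := by
      simp [gDeriv, gPoly_zero]; ring
    rw [zCoeff, this, map_add, h1, h3, add_zero]
  · have : gDeriv 1 n = C (-(n 0 : ℝ)) := by
      simp [gDeriv, gPoly_zero, Derivation.leibniz]
    rw [zCoeff, this, h2]

end

noncomputable section

open MvPolynomial

variable {r : ℕ}

/-! ### Homogeneity in the variables `v_j` -/

/-- The span of the monomials `u^l v^m` with `m_1 + ⋯ + m_{r+1} = d`. -/
def vHomog (r : ℕ) (d : ℤ) : Submodule ℤ (UV r) :=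
  Submodule.span ℤ {P | ∃ (l : Fin (r + 1) →₀ ℕ) (m : Fin (r + 1) → ℤ),
    ∑ j, m j = d ∧ P = monomial l (AddMonoidAlgebra.single m 1)}

lemma monomial_mem_vHomog (l : Fin (r + 1) →₀ ℕ) (m : Fin (r + 1) → ℤ) :
    monomial l (AddMonoidAlgebra.single m 1) ∈ vHomog r (∑ j, m j) :=
  Submodule.subset_span ⟨l, m, rfl, rfl⟩

lemma one_mem_vHomog : (1 : UV r) ∈ vHomog r 0 := by
  have h := monomial_mem_vHomog (r := r) 0 0
  simpa [← AddMonoidAlgebra.one_def] using h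

lemma X_mem_vHomog (i : Fin (r + 1)) : (X i : UV r) ∈ vHomog r 0 := by
  have h := monomial_mem_vHomog (r := r) (Finsupp.single i 1) 0
  simpa [← AddMonoidAlgebra.one_def, X] using h

lemma vpow_mem_vHomog (j : Fin (r + 1)) (e : ℤ) : vpow j e ∈ vHomog r e := by
  have h := monomial_mem_vHomog (r := r) 0 (Pi.single j e)
  simpa [vpow] using h

lemma mul_mem_vHomog {d e : ℤ} {P Q : UV r} (hP : P ∈ vHomog r d) (hQ : Q ∈ vHomog r e) :
    P * Q ∈ vHomog r (d + e) := by
  have h := Submodule.mul_mem_mul hP hQ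
  rw [vHomog, vHomog, Submodule.span_mul_span] at h
  refine Submodule.span_mono ?_ h
  rintro _ ⟨_, ⟨l, m, hm, rfl⟩, _, ⟨l', m', hm', rfl⟩, rfl⟩
  refine ⟨l + l', m + m', ?_, ?_⟩
  · simp [Finset.sum_add_distrib, hm, hm']
  · simp [monomial_mul, AddMonoidAlgebra.single_mul_single]

lemma vinvPrev_mem_vHomog (j : Fin (r + 1)) : vinvPrev j ∈ vHomog r (-1) := by
  induction j using Fin.cases with
  | zero => exact zero_mem _
  | succ i => exact vpow_mem_vHomog _ _

lemma G_mem_vHomog : G r ∈ vHomog r 0 := by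
  rw [G]
  refine Finset.prod_induction _ (· ∈ vHomog r 0) (fun P Q hP hQ => ?_) one_mem_vHomog ?_
  · simpa using mul_mem_vHomog hP hQ
  · intro j _
    refine sub_mem one_mem_vHomog ?_
    have h1 : ∑ i ∈ Finset.Ici j, X i * vpow i 1 ∈ vHomog r 1 := by
      refine sum_mem fun i _ => ?_
      simpa using mul_mem_vHomog (X_mem_vHomog i) (vpow_mem_vHomog i 1)
    simpa using mul_mem_vHomog h1 (sub_mem (vpow_mem_vHomog j (-1)) (vinvPrev_mem_vHomog j))

lemma pderiv_mem_vHomog {d : ℤ} {P : UV r} (i : Fin (r + 1)) (hP : P ∈ vHomog r d) :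
    pderiv i P ∈ vHomog r d := by
  induction hP using Submodule.span_induction with
  | mem P hP =>
    obtain ⟨l, m, rfl, rfl⟩ := hP
    rw [pderiv_monomial, mul_comm, ← nsmul_eq_mul, map_nsmul]
    exact nsmul_mem (monomial_mem_vHomog _ _) _
  | zero => simp
  | add P Q _ _ hP hQ => rw [map_add]; exact add_mem hP hQ
  | smul c P _ hP => rw [map_zsmul]; exact zsmul_mem hP c

/-- Homogeneity shows that the condition `m_1 + ⋯ + m_{r+1} = -q` in `polylogComb` discards no
monomial. -/
lemma Gq_mem_vHomog (q : ℕ) : Gq r q ∈ vHomog r (-(q : ℤ)) := by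
  induction q with
  | zero => simpa [Gq] using G_mem_vHomog
  | succ q ih =>
    rw [Gq, Function.iterate_succ_apply', ← Gq]
    have h := mul_mem_vHomog (vpow_mem_vHomog (Fin.last r) (-1))
      (pderiv_mem_vHomog (Fin.last r) ih)
    convert h using 2
    · push_cast; ring
    · rfl

lemma sum_eq_of_mem_vHomog {d : ℤ} {P : UV r} (hP : P ∈ vHomog r d) (l : Fin (r + 1) →₀ ℕ)
    (m : Fin (r + 1) → ℤ) (h : (P.coeff l).coeff m ≠ 0) : ∑ j, m j = d := by
  by_contra hne
  apply h
  clear h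
  induction hP using Submodule.span_induction with
  | mem P hP =>
    obtain ⟨l', m', hm', rfl⟩ := hP
    rw [coeff_monomial]
    split_ifs
    · rw [AddMonoidAlgebra.coeff_single, Finsupp.single_apply, if_neg]
      rintro rfl
      exact hne hm'
    · simp
  | zero => simp
  | add P Q _ _ hP hQ => simp [hP, hQ]
  | smul c P _ hP =>
    have h : coeff l (c • P) = c • coeff l P := map_zsmul (coeffAddMonoidHom l) c P
    rw [h, AddMonoidAlgebra.coeff_smul, Finsupp.smul_apply, hP, smul_zero]

/-! ### Specialisation of `𝒢` at a tuple of integers -/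

/-- The substitution `v_j ↦ n_j⁻¹`. -/
def evalV (n : IncTuple r) : Laurent r →+* ℝ :=
  AddMonoidAlgebra.liftNCRingHom (Int.castRingHom ℝ)
    { toFun := fun m => ∏ j, (n.1 j : ℝ) ^ (-(m.toAdd j))
      map_one' := by simp
      map_mul' := fun m m' => by
        rw [← Finset.prod_mul_distrib]
        refine Finset.prod_congr rfl fun j _ => ?_
        rw [← zpow_add₀ (by exact_mod_cast (n.2.2 j).ne')]
        congr 1
        simp [add_comm] }
    (fun _ _ => Commute.all _ _)

lemma evalV_single (n : IncTuple r) (m : Fin (r + 1) → ℤ) (c : ℤ) :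
    evalV n (AddMonoidAlgebra.single m c) = c * ∏ j, (n.1 j : ℝ) ^ (-(m j)) := by
  simp [evalV]

/-- The substitution `v_j ↦ n_j⁻¹`, `u_j ↦ n_j y_j`. -/
def evalUV (n : IncTuple r) : UV r →+* MvPolynomial (Fin (r + 1)) ℝ :=
  eval₂Hom (C.comp (evalV n)) fun j => C (n.1 j : ℝ) * X j

lemma evalUV_X (n : IncTuple r) (j : Fin (r + 1)) : evalUV n (X j) = C (n.1 j : ℝ) * X j := by
  simp [evalUV]

lemma evalUV_C (n : IncTuple r) (c : Laurent r) : evalUV n (C c) = C (evalV n c) := by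
  simp [evalUV]

lemma evalUV_vpow (n : IncTuple r) (j : Fin (r + 1)) (e : ℤ) :
    evalUV n (vpow j e) = C ((n.1 j : ℝ) ^ (-e)) := by
  rw [vpow, evalUV_C, evalV_single, Finset.prod_eq_single j]
  · simp
  · intro i _ hi; simp [hi]
  · simp

lemma evalUV_G (n : IncTuple r) : evalUV n (G r) = gPoly n.1 := by
  rw [G, gPoly, map_prod]
  refine Finset.prod_congr rfl fun j _ => ?_
  rw [map_sub, map_one, map_mul, map_sum, map_sub, evalUV_vpow]
  have h1 : ∀ i, evalUV n (X i * vpow i 1) = X i := by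
    intro i
    have hi : (n.1 i : ℝ) ≠ 0 := by exact_mod_cast (n.2.2 i).ne'
    rw [map_mul, evalUV_X, evalUV_vpow, mul_right_comm, ← C_mul]
    simp [hi]
  have h2 : evalUV n (vinvPrev j) =
      C (Fin.cases (motive := fun _ => ℝ) 0 (fun i => (n.1 i.castSucc : ℝ)) j) := by
    induction j using Fin.cases with
    | zero => simp [vinvPrev]
    | succ i => simp [vinvPrev, evalUV_vpow]
  simp only [h1, h2, diffPrev, neg_neg, zpow_one, C_sub]

lemma evalUV_pderiv (n : IncTuple r) (i : Fin (r + 1)) (P : UV r) :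
    pderiv i (evalUV n P) = C (n.1 i : ℝ) * evalUV n (pderiv i P) := by
  induction P using MvPolynomial.induction_on with
  | C c => simp [evalUV_C]
  | add P Q hP hQ => simp only [map_add, hP, hQ, mul_add]
  | mul_X P j hP =>
    have h : pderiv i (evalUV n (X j)) = C (n.1 i : ℝ) * evalUV n (pderiv i (X j)) := by
      rw [evalUV_X, pderiv_C_mul, pderiv_X, pderiv_X]
      by_cases hj : j = i
      · subst hj; simp
      · simp [hj]
    simp only [map_mul, Derivation.leibniz, hP, h, smul_eq_mul, map_add]
    ring

/-- Chain rule: the factor `n` from `v⁻¹` cancels the factor `n⁻¹` from `u = n y`. -/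
lemma evalUV_vDu (n : IncTuple r) (P : UV r) :
    evalUV n (vDu P) = pderiv (Fin.last r) (evalUV n P) := by
  have hi : (n.1 (Fin.last r) : ℝ) ≠ 0 := by exact_mod_cast (n.2.2 _).ne'
  rw [vDu, map_mul, evalUV_vpow, evalUV_pderiv]
  rw [neg_neg, zpow_one]

lemma evalUV_Gq (n : IncTuple r) (q : ℕ) : evalUV n (Gq r q) = gDeriv q n.1 := by
  induction q with
  | zero => exact evalUV_G n
  | succ q ih => rw [gDeriv_succ, ← ih, ← evalUV_vDu, Gq, Function.iterate_succ_apply', ← Gq]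

lemma mellin_evalUV_monomial (k : Fin (r + 1) → ℤ) (n : IncTuple r) (l : Fin (r + 1) →₀ ℕ)
    (m : Fin (r + 1) → ℤ) (c : ℤ) :
    mellin k n.1 (evalUV n (monomial l (AddMonoidAlgebra.single m c))) =
      c * (∏ j, (poch (k j) (l j) : ℝ)) * LiTerm (k + m) 1 n := by
  have h : evalUV n (monomial l (AddMonoidAlgebra.single m c)) =
      C ((c * ∏ j, (n.1 j : ℝ) ^ (-(m j))) * ∏ j, (n.1 j : ℝ) ^ l j) * ∏ j, X j ^ l j := by
    rw [monomial_eq, map_mul, evalUV_C, evalV_single, Finsupp.prod_fintype _ _ (by simp), map_prod]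
    simp only [map_pow, evalUV_X, mul_pow, Finset.prod_mul_distrib, map_mul, map_prod]
    ring
  rw [h, mellin_C_mul_prod, LiTerm, one_pow, mul_assoc, mul_assoc, mul_assoc, one_div,
    ← Finset.prod_inv_distrib, ← Finset.prod_mul_distrib, ← Finset.prod_mul_distrib,
    ← Finset.prod_mul_distrib]
  congr 1
  refine Finset.prod_congr rfl fun j _ => ?_
  have hj : (n.1 j : ℝ) ≠ 0 := by exact_mod_cast (n.2.2 j).ne'
  -- The powers `n^{-m}` from `v^m`, `n^l` from `u^l` and `n^{-k-l}` from the transform combine to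
  -- `n^{-(k+m)}`.
  rw [weight, ← zpow_natCast (n.1 j : ℝ) (l j), ← zpow_neg, Pi.add_apply,
    show -(k j + m j) = -(m j) + l j + (-k j - l j) by ring, zpow_add₀ hj, zpow_add₀ hj]
  ring

lemma zCoeff_eq_sum (q : ℕ) (k : Fin (r + 1) → ℤ) (n : IncTuple r) :
    zCoeff q k n.1 = ∑ l ∈ (Gq r q).support,
      ∑ m ∈ ((Gq r q).coeff l).coeff.support with ∑ j, m j = -(q : ℤ),
        (a q l m : ℝ) * (∏ j, (poch (k j) (l j) : ℝ)) * LiTerm (k + m) 1 n := by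
  rw [zCoeff, ← evalUV_Gq]
  conv_lhs => rw [(Gq r q).as_sum]
  rw [map_sum, map_sum]
  refine Finset.sum_congr rfl fun l _ => ?_
  rw [Finset.filter_true_of_mem fun m hm => sum_eq_of_mem_vHomog (Gq_mem_vHomog q) l m
    (Finsupp.mem_support_iff.1 hm)]
  conv_lhs => rw [← AddMonoidAlgebra.sum_coeff_single ((Gq r q).coeff l)]
  rw [Finsupp.sum, map_sum, map_sum, map_sum]
  exact Finset.sum_congr rfl fun m _ => mellin_evalUV_monomial k n l m _

end

noncomputable section

variable {r : ℕ}

/-! ### Increasing tuples -/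

/-- Appending a larger entry identifies `IncTuple r × ℕ` with `IncTuple (r + 1)`. -/
def snocEquiv (r : ℕ) : IncTuple r × ℕ ≃ IncTuple (r + 1) where
  toFun p := ⟨Fin.snoc (α := fun _ => ℕ) p.1.1 (p.1.1 (Fin.last r) + p.2 + 1), by
    constructor
    · intro i j hij
      induction j using Fin.lastCases with
      | last =>
        induction i using Fin.lastCases with
        | last => exact absurd hij (lt_irrefl _)
        | cast i =>
          simp only [Fin.snoc_castSucc, Fin.snoc_last]
          have := p.1.2.1.monotone (Fin.le_last i)
          omega
      | cast j =>
        induction i using Fin.lastCases with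
        | last => exact absurd hij (Fin.castSucc_lt_last j).not_gt
        | cast i =>
          simp only [Fin.snoc_castSucc]
          exact p.1.2.1 (Fin.castSucc_lt_castSucc_iff.1 hij)
    · intro i
      induction i using Fin.lastCases with
      | last => simp
      | cast i => simpa using p.1.2.2 i⟩
  invFun n := (⟨Fin.init n.1, fun _ _ h => n.2.1 (Fin.castSucc_lt_castSucc_iff.2 h),
    fun i => n.2.2 i.castSucc⟩, n.1 (Fin.last (r + 1)) - n.1 (Fin.last r).castSucc - 1)
  left_inv p := by
    refine Prod.ext (Subtype.ext ?_) ?_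
    · simp
    · simp only [Fin.snoc_last, Fin.snoc_castSucc]
      omega
  right_inv n := by
    refine Subtype.ext (funext fun i => ?_)
    have h := n.2.1 (Fin.castSucc_lt_last (Fin.last r))
    induction i using Fin.lastCases with
    | last =>
      simp only [Fin.snoc_last, Fin.init]
      omega
    | cast i => simp [Fin.init]

lemma snocEquiv_last (p : IncTuple r × ℕ) :
    (snocEquiv r p).1 (Fin.last (r + 1)) = p.1.1 (Fin.last r) + p.2 + 1 := by
  simp [snocEquiv]

lemma snocEquiv_castSucc (p : IncTuple r × ℕ) (i : Fin (r + 1)) :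
    (snocEquiv r p).1 i.castSucc = p.1.1 i := by
  simp [snocEquiv]

lemma init_snocEquiv (p : IncTuple r × ℕ) : Fin.init (snocEquiv r p).1 = p.1.1 :=
  funext fun i => snocEquiv_castSucc p i

lemma diffPrev_snocEquiv (p : IncTuple r × ℕ) :
    diffPrev (snocEquiv r p).1 (Fin.last (r + 1)) = (p.2 : ℝ) + 1 := by
  rw [diffPrev_last, snocEquiv_last, snocEquiv_castSucc]
  push_cast; ring

/-- Tuples of length one are positive integers. -/
def singleEquiv : ℕ ≃ IncTuple 0 where
  toFun d := ⟨fun _ => d + 1, Subsingleton.strictMono (α := Fin 1) _, fun _ => Nat.succ_pos _⟩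
  invFun n := n.1 0 - 1
  left_inv d := by simp
  right_inv n := by
    refine Subtype.ext (funext fun i => ?_)
    have h := n.2.2 0
    have hi : i = 0 := Subsingleton.elim (α := Fin 1) _ _
    subst hi
    simp only
    omega

/-! ### Summability -/

lemma LiTerm_nonneg (k : Fin (r + 1) → ℤ) {t : ℝ} (ht : 0 ≤ t) (n : IncTuple r) :
    0 ≤ LiTerm k t n := by
  unfold LiTerm; positivity

lemma LiTerm_eq (k : Fin (r + 1) → ℤ) (t : ℝ) (n : IncTuple r) :
    LiTerm k t n = LiTerm k 1 n * t ^ n.1 (Fin.last r) := by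
  simp only [LiTerm, one_pow]; ring

lemma LiTerm_lowerLast (k : Fin (r + 1) → ℤ) (j : ℕ) (t : ℝ) (n : IncTuple r) :
    LiTerm (lowerLast k j) t n = LiTerm k t n * (n.1 (Fin.last r) : ℝ) ^ j := by
  have h : (n.1 (Fin.last r) : ℝ) ≠ 0 := by exact_mod_cast (n.2.2 _).ne'
  have h3 : ∀ i : Fin r, Function.update k (Fin.last r) (k (Fin.last r) - j) i.castSucc
      = k i.castSucc := fun i => Function.update_of_ne (Fin.castSucc_lt_last i).ne _ _
  simp only [LiTerm, Fin.prod_univ_castSucc, lowerLast, h3, Function.update_self]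
  rw [zpow_sub₀ h, zpow_natCast]
  field_simp

lemma LiTerm_snocEquiv (k : Fin (r + 2) → ℤ) (t : ℝ) (p : IncTuple r × ℕ) :
    LiTerm k t (snocEquiv r p) = LiTerm (Fin.init k) t p.1 *
      (t ^ (p.2 + 1) * ((p.1.1 (Fin.last r) + (p.2 + 1) : ℕ) : ℝ) ^ (-k (Fin.last (r + 1)))) := by
  simp only [LiTerm, Fin.prod_univ_castSucc (n := r + 1), snocEquiv_last, snocEquiv_castSucc,
    Fin.init, add_assoc, zpow_neg]
  rw [pow_add]
  field_simp

lemma zpow_neg_le_pow_natAbs {x : ℝ} (hx : 1 ≤ x) (k : ℤ) : x ^ (-k) ≤ x ^ k.natAbs := by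
  rw [← zpow_natCast]
  exact zpow_le_zpow_right₀ hx (by omega)

lemma summable_succ_pow_mul_pow (K : ℕ) {t : ℝ} (ht : t ∈ Set.Ioo (0 : ℝ) 1) :
    Summable fun d : ℕ => t ^ (d + 1) * ((d + 1 : ℕ) : ℝ) ^ K := by
  have h := summable_pow_mul_geometric_of_norm_lt_one K (r := t)
    (by rw [Real.norm_eq_abs, abs_of_pos ht.1]; exact ht.2)
  exact ((summable_nat_add_iff 1).2 h).congr fun d => mul_comm _ _

/-- Induction on depth. Writing the last entry as `a + d` with `a, d ≥ 1`, the bound `a + d ≤ 2ad`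
dominates the term by a product of a function of the shorter tuple and a function of `d`. The power
`a^K` is absorbed by lowering the last exponent of the shorter index. -/
lemma summable_LiTerm (k : Fin (r + 1) → ℤ) {t : ℝ} (ht : t ∈ Set.Ioo (0 : ℝ) 1) :
    Summable (LiTerm k t) := by
  induction r with
  | zero =>
    rw [← singleEquiv.summable_iff]
    refine Summable.of_nonneg_of_le (fun d => LiTerm_nonneg k ht.1.le _) (fun d => ?_)
      (summable_succ_pow_mul_pow (k 0).natAbs ht)
    have h : (1 : ℝ) ≤ ((d + 1 : ℕ) : ℝ) := by exact_mod_cast Nat.succ_pos d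
    have h2 := zpow_neg_le_pow_natAbs h (k 0)
    have h3 : LiTerm k t (singleEquiv d) = t ^ (d + 1) * ((d + 1 : ℕ) : ℝ) ^ (-k 0) := by
      simp [LiTerm, singleEquiv, div_eq_mul_inv]
    rw [Function.comp_apply, h3]
    have := ht.1
    gcongr
  | succ r ih =>
    rw [← (snocEquiv r).summable_iff]
    set K := (k (Fin.last (r + 1))).natAbs with hK
    refine Summable.of_nonneg_of_le (fun d => LiTerm_nonneg k ht.1.le _) (fun p => ?_)
      ((ih (lowerLast (Fin.init k) K)).mul_of_nonneg
        ((summable_succ_pow_mul_pow K ht).mul_left (2 ^ K))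
        (fun n => LiTerm_nonneg _ ht.1.le n) (fun d => by have := ht.1; positivity))
    rw [Function.comp_apply, LiTerm_snocEquiv, LiTerm_lowerLast, mul_assoc]
    refine mul_le_mul_of_nonneg_left ?_ (LiTerm_nonneg _ ht.1.le _)
    have ha : 1 ≤ p.1.1 (Fin.last r) := p.1.2.2 _
    have h1 : p.1.1 (Fin.last r) + (p.2 + 1) ≤ 2 * p.1.1 (Fin.last r) * (p.2 + 1) := by nlinarith
    have h2 : ((p.1.1 (Fin.last r) + (p.2 + 1) : ℕ) : ℝ) ^ (-k (Fin.last (r + 1))) ≤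
        (2 * (p.1.1 (Fin.last r) : ℝ) * ((p.2 + 1 : ℕ) : ℝ)) ^ K := by
      refine (zpow_neg_le_pow_natAbs (by exact_mod_cast (by omega)) _).trans ?_
      exact pow_le_pow_left₀ (by positivity) (by exact_mod_cast h1) _
    refine (mul_le_mul_of_nonneg_left h2 (pow_nonneg ht.1.le _)).trans_eq ?_
    rw [mul_pow, mul_pow]
    ring

/-! ### Series in `t^{n_{r+1}}` -/

/-- The series `∑_n c_n t^{n_{r+1}}`. -/
def series (c : IncTuple r → ℝ) (t : ℝ) : ℝ := ∑' n, c n * t ^ n.1 (Fin.last r)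

/-- Convergence of `∑_n c_n t^{n_{r+1}}` for all `0 < t < 1`. -/
def Convergent (c : IncTuple r → ℝ) : Prop :=
  ∀ t ∈ Set.Ioo (0 : ℝ) 1, Summable fun n => c n * t ^ n.1 (Fin.last r)

namespace Convergent

variable {c c' : IncTuple r → ℝ}

lemma const_mul (hc : Convergent c) (x : ℝ) : Convergent fun n => x * c n := fun t ht =>
  ((hc t ht).mul_left x).congr fun n => by ring

lemma sum {ι : Type*} (s : Finset ι) (c : ι → IncTuple r → ℝ)
    (hc : ∀ i ∈ s, Convergent (c i)) : Convergent fun n => ∑ i ∈ s, c i n := fun t ht => by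
  simp only [Finset.sum_mul]
  exact summable_sum fun i hi => hc i hi t ht

/-- Comparison with the series at some `s` in `(t, 1)`, as `N (t/s)^N` is bounded in `N`. -/
lemma mul_last (hc : Convergent c) : Convergent fun n => (n.1 (Fin.last r) : ℝ) * c n := by
  intro t ht
  obtain ⟨s, hts, hs1⟩ := exists_between ht.2
  have hs : 0 < s := ht.1.trans hts
  have hlt : t / s < 1 := (div_lt_one hs).2 hts
  have htend := tendsto_self_mul_const_pow_of_lt_one (div_nonneg ht.1.le hs.le) hlt
  obtain ⟨M, hM⟩ := htend.bddAbove_range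
  refine Summable.of_norm_bounded (((hc s ⟨hs, hs1⟩).abs).mul_left M) fun n => ?_
  have h : (n.1 (Fin.last r) : ℝ) * (t / s) ^ n.1 (Fin.last r) ≤ M := hM ⟨n.1 (Fin.last r), rfl⟩
  rw [div_pow, ← mul_div_assoc, div_le_iff₀ (pow_pos hs _)] at h
  rw [Real.norm_eq_abs, abs_mul, abs_mul, abs_mul, Nat.abs_cast, abs_of_pos (pow_pos ht.1 _),
    abs_of_pos (pow_pos hs _)]
  calc _ = (n.1 (Fin.last r) * t ^ n.1 (Fin.last r)) * |c n| := by ring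
    _ ≤ (M * s ^ n.1 (Fin.last r)) * |c n| := mul_le_mul_of_nonneg_right h (abs_nonneg _)
    _ = _ := by ring

lemma mul_last_pow (hc : Convergent c) (i : ℕ) :
    Convergent fun n => (n.1 (Fin.last r) : ℝ) ^ i * c n := by
  induction i with
  | zero => simpa using hc
  | succ i ih =>
    have h := ih.mul_last
    simpa only [pow_succ', mul_assoc] using h

lemma hasDerivAt (hc : Convergent c) {t : ℝ} (ht : t ∈ Set.Ioo (0 : ℝ) 1) :
    HasDerivAt (series c) (series (fun n => (n.1 (Fin.last r) : ℝ) * c n) t / t) t := by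
  obtain ⟨s, hts, hs1⟩ := exists_between ht.2
  have hs : 0 < s := ht.1.trans hts
  -- The majorant on `(t/2, s)`: with `N` the last entry, `z^(N-1) ≤ s^(N-1) ≤ (2/t) s^N`, because
  -- `2s/t ≥ 1`.
  have hu := ((hc.mul_last s ⟨hs, hs1⟩).abs).mul_left (2 / t)
  have h := hasDerivAt_tsum_of_isPreconnected (t := Set.Ioo (t / 2) s)
    (g := fun n z => c n * z ^ n.1 (Fin.last r))
    (g' := fun n z => c n * (n.1 (Fin.last r) * z ^ (n.1 (Fin.last r) - 1))) hu isOpen_Ioo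
    isPreconnected_Ioo (fun n z _ => (hasDerivAt_pow _ z).const_mul _) (fun n z hz => ?_)
    (⟨half_lt_self ht.1, hts⟩ : t ∈ Set.Ioo (t / 2) s) (hc t ht) ⟨half_lt_self ht.1, hts⟩
  · refine HasDerivAt.congr_deriv (f := series c) h ?_
    rw [series, ← tsum_div_const]
    refine tsum_congr fun n => ?_
    have hn := n.2.2 (Fin.last r)
    obtain ⟨m, hm⟩ := Nat.exists_eq_succ_of_ne_zero hn.ne'
    rw [hm, Nat.succ_sub_one, pow_succ]
    have := ht.1.ne'
    field_simp
  · have hn := n.2.2 (Fin.last r)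
    obtain ⟨m, hm⟩ := Nat.exists_eq_succ_of_ne_zero hn.ne'
    have hz0 : 0 < z := (half_pos ht.1).trans hz.1
    beta_reduce
    rw [hm, Nat.succ_sub_one, Real.norm_eq_abs, abs_mul, abs_mul, abs_mul, abs_mul,
      abs_of_pos (pow_pos hz0 _), abs_of_pos (pow_pos hs _)]
    have h1 : z ^ m ≤ 2 / t * s ^ (m + 1) := by
      have h2 : 2 / t * s ^ (m + 1) = (2 * s / t) * s ^ m := by ring
      have h3 : (1 : ℝ) ≤ 2 * s / t := by rw [le_div_iff₀ ht.1]; linarith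
      rw [h2]
      calc z ^ m ≤ s ^ m := pow_le_pow_left₀ hz0.le hz.2.le _
        _ = 1 * s ^ m := (one_mul _).symm
        _ ≤ _ := mul_le_mul_of_nonneg_right h3 (pow_nonneg hs.le _)
    calc _ = |((m.succ : ℕ) : ℝ)| * |c n| * z ^ m := by ring
      _ ≤ |((m.succ : ℕ) : ℝ)| * |c n| * (2 / t * s ^ (m + 1)) := by gcongr
      _ = _ := by rw [Nat.succ_eq_add_one]; ring

/-- The last entry is at least `1`, so each term at `t` is at most `t/s` times its absolute value at
`s`. -/
lemma exists_bound (hc : Convergent c) {s : ℝ} (hs : s ∈ Set.Ioo (0 : ℝ) 1) :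
    ∃ M, ∀ t ∈ Set.Ioc (0 : ℝ) s, |series c t| ≤ M * t := by
  refine ⟨(∑' n : IncTuple r, |c n * s ^ n.1 (Fin.last r)|) / s, fun t ht => ?_⟩
  have h := (((hc s hs).abs).mul_right (t / s)).hasSum
  refine (tsum_of_norm_bounded (f := fun n => c n * t ^ n.1 (Fin.last r)) h
    fun n => ?_).trans_eq ?_
  · have hn := n.2.2 (Fin.last r)
    obtain ⟨m, hm⟩ := Nat.exists_eq_succ_of_ne_zero hn.ne'
    rw [hm, Real.norm_eq_abs, abs_mul, abs_mul, abs_of_pos (pow_pos ht.1 _),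
      abs_of_pos (pow_pos hs.1 _), mul_assoc]
    refine mul_le_mul_of_nonneg_left ?_ (abs_nonneg _)
    have h1 : s ^ m.succ * (t / s) = s ^ m * t := by
      have := hs.1.ne'
      rw [pow_succ]; field_simp
    rw [h1, pow_succ]
    exact mul_le_mul_of_nonneg_right (pow_le_pow_left₀ ht.1.le ht.2 _) ht.1.le
  · rw [tsum_mul_right]; ring

lemma iterate_D (hc : Convergent c) (i : ℕ) :
    Set.EqOn (D^[i] (series c)) (series fun n => (n.1 (Fin.last r) : ℝ) ^ i * c n)
      (Set.Ioo 0 1) := by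
  induction i with
  | zero => intro t _; simp
  | succ i ih =>
    intro t ht
    rw [Function.iterate_succ_apply', D]
    have h := (hc.mul_last_pow i).hasDerivAt ht
    rw [(h.congr_of_eventuallyEq (ih.eventuallyEq_of_mem (isOpen_Ioo.mem_nhds ht))).deriv,
      mul_div_cancel₀ _ ht.1.ne']
    simp only [pow_succ', mul_assoc]

end Convergent

lemma series_sum {ι : Type*} (s : Finset ι) (x : ι → ℝ) (c : ι → IncTuple r → ℝ)
    (hc : ∀ i ∈ s, Convergent (c i)) {t : ℝ} (ht : t ∈ Set.Ioo (0 : ℝ) 1) :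
    series (fun n => ∑ i ∈ s, x i * c i n) t = ∑ i ∈ s, x i * series (c i) t := by
  simp only [series, Finset.sum_mul]
  rw [Summable.tsum_finsetSum fun i hi => ?_]
  · refine Finset.sum_congr rfl fun i _ => ?_
    rw [← tsum_mul_left]
    exact tsum_congr fun n => mul_assoc _ _ _
  · exact (hc i hi).const_mul (x i) t ht

end

noncomputable section

variable {r : ℕ}

/-! ### The combinations of polylogarithms as series -/

lemma convergent_LiTerm (k : Fin (r + 1) → ℤ) : Convergent (LiTerm k 1) := fun t ht =>
  (summable_LiTerm k ht).congr fun n => LiTerm_eq k t n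

lemma Li_eq_series (k : Fin (r + 1) → ℤ) (t : ℝ) : Li k t = series (LiTerm k 1) t :=
  tsum_congr fun n => LiTerm_eq k t n

lemma convergent_zCoeff (q : ℕ) (k : Fin (r + 1) → ℤ) :
    Convergent fun n : IncTuple r => zCoeff q k n.1 := by
  simp only [zCoeff_eq_sum]
  exact Convergent.sum _ _ fun l _ => Convergent.sum _ _ fun m _ =>
    (convergent_LiTerm _).const_mul _

lemma polylogComb_eq_series (q : ℕ) (k : Fin (r + 1) → ℤ) {t : ℝ} (ht : t ∈ Set.Ioo (0 : ℝ) 1) :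
    polylogComb q k t = series (fun n => zCoeff q k n.1) t := by
  simp only [zCoeff_eq_sum]
  have h := series_sum (Gq r q).support (fun _ => 1)
    (fun l n => ∑ m ∈ ((Gq r q).coeff l).coeff.support with ∑ j, m j = -(q : ℤ),
        (a q l m : ℝ) * (∏ j, (poch (k j) (l j) : ℝ)) * LiTerm (k + m) 1 n)
    (fun l _ => Convergent.sum _ _ fun m _ => (convergent_LiTerm _).const_mul _) ht
  simp only [one_mul] at h
  rw [h, polylogComb]
  refine Finset.sum_congr rfl fun l _ => ?_
  rw [series_sum _ _ _ (fun m _ => convergent_LiTerm (k + m)) ht]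
  simp only [Li_eq_series]

lemma polylogComb_eq_zero (q : ℕ) (k : Fin (r + 1) → ℤ) (hq : r + 1 < q) {t : ℝ}
    (ht : t ∈ Set.Ioo (0 : ℝ) 1) : polylogComb q k t = 0 := by
  simp [polylogComb_eq_series q k ht, zCoeff_eq_zero q k _ hq, series]

lemma lowerLast_last (k : Fin (r + 1) → ℤ) (j : ℤ) :
    lowerLast k j (Fin.last r) = k (Fin.last r) - j := Function.update_self _ _ _

lemma lowerLast_lowerLast (k : Fin (r + 1) → ℤ) (i j : ℤ) :
    lowerLast (lowerLast k i) j = lowerLast k (i + j) := by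
  simp only [lowerLast, Function.update_self, Function.update_idem, sub_sub]

lemma lowerLast_zero (k : Fin (r + 1) → ℤ) : lowerLast k 0 = k := by
  simp [lowerLast]

lemma init_lowerLast (k : Fin (r + 2) → ℤ) (j : ℤ) : Fin.init (lowerLast k j) = Fin.init k :=
  funext fun i => Function.update_of_ne (Fin.castSucc_lt_last i).ne _ _

/-- The binomial theorem for `(x - E)^q`, where `E` is the shift `b ↦ b + 1`. -/
lemma eq_sum_antidiagonal_of_rec (f : ℕ → ℤ → ℝ) (x : ℝ)
    (hf : ∀ q b, f (q + 1) b = x * f q b - f q (b + 1)) (q : ℕ) (b : ℤ) :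
    f q b = ∑ p ∈ Finset.HasAntidiagonal.antidiagonal q,
      (q.choose p.1 : ℝ) * ((-1 : ℝ) ^ p.2 * x ^ p.1 * f 0 (b + p.2)) := by
  induction q generalizing b with
  | zero => simp
  | succ q ih =>
    rw [Finset.sum_antidiagonal_choose_succ_mul
      (fun i j => (-1 : ℝ) ^ j * x ^ i * f 0 (b + j)) q, hf, ih b, ih (b + 1), sub_eq_neg_add,
      ← Finset.sum_neg_distrib, Finset.mul_sum]
    congr 1
    · refine Finset.sum_congr rfl fun p _ => ?_
      rw [show b + 1 + (p.2 : ℤ) = b + ((p.2 + 1 : ℕ) : ℤ) by push_cast; ring]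
      ring
    · refine Finset.sum_congr rfl fun p hp => ?_
      -- Pascal's rule produces this half with `q.choose p.2`.
      rw [Nat.choose_symm_of_eq_add (Finset.HasAntidiagonal.mem_antidiagonal.1 hp).symm]
      ring

lemma zCoeff_eq_sum_antidiagonal (q : ℕ) (k : Fin (r + 1) → ℤ) (n : IncTuple r) :
    zCoeff q k n.1 = ∑ p ∈ Finset.HasAntidiagonal.antidiagonal q,
      ((-1 : ℝ) ^ p.2 * (q.choose p.1 : ℝ)) *
        ((n.1 (Fin.last r) : ℝ) ^ p.1 * zCoeff 0 (lowerLast k p.2) n.1) := by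
  have h := eq_sum_antidiagonal_of_rec (fun q b => zCoeff q (lowerLast k b) n.1)
    (n.1 (Fin.last r)) (fun q b => by
      simp only [zCoeff_succ q _ n.1 (n.2.2 _).ne', lowerLast_lowerLast]) q 0
  simp only [lowerLast_zero, zero_add] at h
  rw [h]
  exact Finset.sum_congr rfl fun p _ => by ring

lemma Zq_eq_polylogComb (q : ℕ) (k : Fin (r + 1) → ℤ) {t : ℝ} (ht : t ∈ Set.Ioo (0 : ℝ) 1) :
    Zq q k t = polylogComb q k t := by
  rw [polylogComb_eq_series q k ht]
  simp only [zCoeff_eq_sum_antidiagonal q k]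
  rw [series_sum (Finset.HasAntidiagonal.antidiagonal q)
    (fun p => (-1 : ℝ) ^ p.2 * (q.choose p.1 : ℝ))
    (fun p n => (n.1 (Fin.last r) : ℝ) ^ p.1 * zCoeff 0 (lowerLast k p.2) n.1)
    (fun p _ => (convergent_zCoeff 0 (lowerLast k p.2)).mul_last_pow p.1) ht, Zq]
  refine Finset.sum_congr rfl fun p _ => ?_
  have h : Set.EqOn (Z0 (lowerLast k p.2))
      (series fun n : IncTuple r => zCoeff 0 (lowerLast k p.2) n.1) (Set.Ioo 0 1) :=
    fun s hs => polylogComb_eq_series 0 _ hs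
  have hD : ∀ i, Set.EqOn (D^[i] (Z0 (lowerLast k p.2)))
      (D^[i] (series fun n : IncTuple r => zCoeff 0 (lowerLast k p.2) n.1)) (Set.Ioo 0 1) := by
    intro i
    induction i with
    | zero => exact h
    | succ i ih =>
      intro s hs
      rw [Function.iterate_succ_apply', Function.iterate_succ_apply', D, D,
        (ih.eventuallyEq_of_mem (isOpen_Ioo.mem_nhds hs)).deriv_eq]
  have hS := (convergent_zCoeff 0 (lowerLast k p.2)).iterate_D p.1 ht
  exact congrArg _ ((hD p.1 ht).trans hS)

lemma hasDerivAt_polylogComb (q : ℕ) (k : Fin (r + 1) → ℤ) {t : ℝ} (ht : t ∈ Set.Ioo (0 : ℝ) 1) :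
    HasDerivAt (polylogComb q k)
      ((polylogComb (q + 1) k t + polylogComb q (lowerLast k 1) t) / t) t := by
  have h0 : Set.EqOn (polylogComb q k) (series fun n : IncTuple r => zCoeff q k n.1)
      (Set.Ioo 0 1) := fun s hs => polylogComb_eq_series q k hs
  refine (((convergent_zCoeff q k).hasDerivAt ht).congr_of_eventuallyEq
    (h0.eventuallyEq_of_mem (isOpen_Ioo.mem_nhds ht))).congr_deriv ?_
  rw [polylogComb_eq_series _ k ht, polylogComb_eq_series _ _ ht, series, series, series,
    ← (convergent_zCoeff (q + 1) k t ht).tsum_add (convergent_zCoeff q (lowerLast k 1) t ht)]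
  congr 1
  refine tsum_congr fun n => ?_
  beta_reduce
  rw [zCoeff_succ q k n.1 (n.2.2 _).ne']
  ring

/-! ### The candidate for `desLi` -/

/-- The sum `∑_q (-log t)^q / q! * Z_q(k; t)`. -/
def desSum (k : Fin (r + 1) → ℤ) (t : ℝ) : ℝ :=
  ∑ q ∈ Finset.range (r + 2), (-Real.log t) ^ q / (q.factorial : ℝ) * polylogComb q k t

lemma sum_shift (r : ℕ) (x : ℝ) (P : ℕ → ℝ) (hP : P (r + 2) = 0) :
    ∑ q ∈ Finset.range (r + 2), (q : ℝ) * x ^ (q - 1) / (q.factorial : ℝ) * P q =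
      ∑ q ∈ Finset.range (r + 2), x ^ q / (q.factorial : ℝ) * P (q + 1) := by
  rw [Finset.sum_range_succ', Finset.sum_range_succ _ (r + 1), hP]
  simp only [Nat.cast_zero, zero_mul, zero_div, mul_zero, add_zero]
  refine Finset.sum_congr rfl fun q _ => ?_
  rw [Nat.factorial_succ, Nat.add_sub_cancel]
  push_cast
  have h1 : (q.factorial : ℝ) ≠ 0 := by exact_mod_cast q.factorial_ne_zero
  have h2 : (q : ℝ) + 1 ≠ 0 := by positivity
  field_simp

/-- Differentiating the power of `log t` in the term `q + 1` cancels the `polylogComb (q + 1)` part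
of the derivative of the term `q`; the top part vanishes by `polylogComb_eq_zero`. -/
lemma hasDerivAt_desSum (k : Fin (r + 1) → ℤ) {t : ℝ} (ht : t ∈ Set.Ioo (0 : ℝ) 1) :
    HasDerivAt (desSum k) (desSum (lowerLast k 1) t / t) t := by
  have h := HasDerivAt.fun_sum (u := Finset.range (r + 2)) fun q _ =>
    ((((Real.hasDerivAt_log ht.1.ne').neg.pow q).div_const (q.factorial : ℝ)).mul
      (hasDerivAt_polylogComb q k ht))
  refine HasDerivAt.congr_deriv (f := desSum k) h ?_
  have hs := sum_shift r (-Real.log t) (fun q => polylogComb q k t)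
    (polylogComb_eq_zero (r + 2) k (by omega) ht)
  rw [desSum, Finset.sum_div, ← sub_eq_zero, ← Finset.sum_sub_distrib]
  rw [← sub_eq_zero, ← Finset.sum_sub_distrib] at hs
  calc _ = ∑ q ∈ Finset.range (r + 2), (-1 / t) *
        ((q : ℝ) * (-Real.log t) ^ (q - 1) / (q.factorial : ℝ) * polylogComb q k t -
          (-Real.log t) ^ q / (q.factorial : ℝ) * polylogComb (q + 1) k t) := by
        refine Finset.sum_congr rfl fun q _ => ?_
        simp only [Pi.neg_apply, Pi.pow_apply]
        ring
    _ = 0 := by rw [← Finset.mul_sum, hs, mul_zero]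

/-- Apply `x^q / q! ≤ e^x` at `x = -log t / 2`, where `e^x = t^(-1/2)`; the halving costs `2^q`. The
remaining `t^(1/2)` gives both the limit `0` and integrability after division by `t`. -/
lemma log_pow_mul_le (q : ℕ) {t : ℝ} (ht : t ∈ Set.Ioo (0 : ℝ) 1) :
    |(-Real.log t) ^ q / (q.factorial : ℝ)| * t ≤ 2 ^ q * t ^ (1 / 2 : ℝ) := by
  have hl : 0 ≤ -Real.log t / 2 := by linarith [Real.log_neg ht.1 ht.2]
  have h := Real.pow_div_factorial_le_exp _ hl q
  have h1 : (-Real.log t) ^ q / (q.factorial : ℝ) =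
      2 ^ q * ((-Real.log t / 2) ^ q / (q.factorial : ℝ)) := by
    rw [div_pow]; field_simp
  have h2 : Real.exp (-Real.log t / 2) * t = t ^ (1 / 2 : ℝ) := by
    nth_rewrite 2 [← Real.exp_log ht.1]
    rw [← Real.exp_add, Real.rpow_def_of_pos ht.1]
    congr 1; ring
  rw [h1, abs_of_nonneg (by positivity), mul_assoc, ← h2]
  have := ht.1
  gcongr

lemma exists_bound_desSum (k : Fin (r + 1) → ℤ) {s : ℝ} (hs : s ∈ Set.Ioo (0 : ℝ) 1) :
    ∃ M, ∀ t ∈ Set.Ioc (0 : ℝ) s, |desSum k t| ≤ M * t ^ (1 / 2 : ℝ) := by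
  choose M hM using fun q => (convergent_zCoeff q k).exists_bound hs
  refine ⟨∑ q ∈ Finset.range (r + 2), |M q| * 2 ^ q, fun t ht => ?_⟩
  have ht' : t ∈ Set.Ioo (0 : ℝ) 1 := ⟨ht.1, ht.2.trans_lt hs.2⟩
  rw [desSum, Finset.sum_mul]
  refine (Finset.abs_sum_le_sum_abs _ _).trans (Finset.sum_le_sum fun q _ => ?_)
  rw [abs_mul, polylogComb_eq_series q k ht']
  have h1 : |series (fun n : IncTuple r => zCoeff q k n.1) t| ≤ |M q| * t :=
    (hM q t ht).trans (mul_le_mul_of_nonneg_right (le_abs_self _) ht.1.le)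
  calc _ ≤ |(-Real.log t) ^ q / (q.factorial : ℝ)| * (|M q| * t) :=
        mul_le_mul_of_nonneg_left h1 (abs_nonneg _)
    _ = |M q| * (|(-Real.log t) ^ q / (q.factorial : ℝ)| * t) := by ring
    _ ≤ |M q| * (2 ^ q * t ^ (1 / 2 : ℝ)) :=
        mul_le_mul_of_nonneg_left (log_pow_mul_le q ht') (abs_nonneg _)
    _ = _ := by ring

lemma tendsto_desSum (k : Fin (r + 1) → ℤ) :
    Filter.Tendsto (desSum k) (nhdsWithin 0 (Set.Ioi 0)) (nhds 0) := by
  obtain ⟨M, hM⟩ := exists_bound_desSum k (s := 1 / 2) (by norm_num)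
  have h : Filter.Tendsto (fun t : ℝ => M * t ^ (1 / 2 : ℝ)) (nhdsWithin 0 (Set.Ioi 0))
      (nhds 0) := by
    have hc : ContinuousAt (fun t : ℝ => M * t ^ (1 / 2 : ℝ)) 0 :=
      continuousAt_const.mul (Real.continuousAt_rpow_const _ _ (by norm_num))
    have h0 := hc.tendsto.mono_left (nhdsWithin_le_nhds (s := Set.Ioi 0))
    simpa [Real.zero_rpow] using h0
  refine squeeze_zero_norm' ?_ h
  filter_upwards [Ioc_mem_nhdsGT (show (0 : ℝ) < 1 / 2 by norm_num)] with t ht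
  exact hM t ht

lemma intervalIntegrable_desSum_div (k : Fin (r + 1) → ℤ) {t : ℝ} (ht : t ∈ Set.Ioo (0 : ℝ) 1) :
    IntervalIntegrable (fun z => desSum k z / z) MeasureTheory.volume 0 t := by
  obtain ⟨M, hM⟩ := exists_bound_desSum k ht
  have hI : IntervalIntegrable (fun z : ℝ => M * z ^ (-(1 / 2) : ℝ)) MeasureTheory.volume 0 t :=
    (intervalIntegral.intervalIntegrable_rpow' (by norm_num)).const_mul M
  rw [intervalIntegrable_iff_integrableOn_Ioc_of_le ht.1.le] at hI ⊢
  refine MeasureTheory.Integrable.mono' hI ?_ ?_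
  · refine ContinuousOn.aestronglyMeasurable (fun z hz => ?_) measurableSet_Ioc
    exact ((hasDerivAt_desSum k ⟨hz.1, hz.2.trans_lt ht.2⟩).continuousAt.div continuousAt_id
      hz.1.ne').continuousWithinAt
  · refine (MeasureTheory.ae_restrict_iff' measurableSet_Ioc).2 (Filter.Eventually.of_forall ?_)
    intro z hz
    rw [Real.norm_eq_abs, abs_div, abs_of_pos hz.1, div_le_iff₀ hz.1, mul_assoc,
      ← Real.rpow_add_one hz.1.ne']
    rw [show (-(1 / 2) + 1 : ℝ) = 1 / 2 by norm_num]
    exact hM z hz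

lemma J_eq_desSum (k : Fin (r + 1) → ℤ) {f : ℝ → ℝ}
    (hf : Set.EqOn f (desSum (lowerLast k 1)) (Set.Ioo 0 1)) :
    Set.EqOn (J f) (desSum k) (Set.Ioo 0 1) := by
  intro t ht
  have h1 : J f t = ∫ z in (0 : ℝ)..t, desSum (lowerLast k 1) z / z := by
    refine intervalIntegral.integral_congr_ae (Filter.Eventually.of_forall fun z hz => ?_)
    rw [Set.uIoc_of_le ht.1.le] at hz
    rw [hf ⟨hz.1, hz.2.trans_lt ht.2⟩]
  rw [h1, intervalIntegral.integral_eq_sub_of_hasDerivAt_of_tendsto ht.1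
    (fun z hz => hasDerivAt_desSum k ⟨hz.1, hz.2.trans ht.2⟩)
    (intervalIntegrable_desSum_div _ ht) (tendsto_desSum k)
    ((hasDerivAt_desSum k ht).continuousAt.tendsto.mono_left nhdsWithin_le_nhds), sub_zero]

lemma D_eq_desSum (k : Fin (r + 1) → ℤ) {f : ℝ → ℝ} (hf : Set.EqOn f (desSum k) (Set.Ioo 0 1)) :
    Set.EqOn (D f) (desSum (lowerLast k 1)) (Set.Ioo 0 1) := by
  intro t ht
  rw [D, ((hasDerivAt_desSum k ht).congr_of_eventuallyEq
    (hf.eventuallyEq_of_mem (isOpen_Ioo.mem_nhds ht))).deriv, mul_div_cancel₀ _ ht.1.ne']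

lemma Jpow_eq_desSum (k : Fin (r + 1) → ℤ) {f : ℝ → ℝ}
    (hf : Set.EqOn f (desSum k) (Set.Ioo 0 1)) (m : ℤ) :
    Set.EqOn (Jpow m f) (desSum (lowerLast k (-m))) (Set.Ioo 0 1) := by
  cases m with
  | ofNat n =>
    simp only [Jpow]
    induction n with
    | zero => simpa [lowerLast_zero] using hf
    | succ n ih =>
      rw [Function.iterate_succ']
      refine J_eq_desSum _ ?_
      rw [lowerLast_lowerLast]
      convert ih using 3
      simp
  | negSucc n =>
    have h : ∀ i : ℕ, Set.EqOn (D^[i] f) (desSum (lowerLast k i)) (Set.Ioo 0 1) := by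
      intro i
      induction i with
      | zero => simpa [lowerLast_zero] using hf
      | succ i ih =>
        rw [Function.iterate_succ']
        have h := D_eq_desSum _ ih
        rw [lowerLast_lowerLast] at h
        exact_mod_cast h
    exact h (n + 1)

/-! ### Multiplication by `desLi0` -/

lemma Li_depth_one (k : ℤ) (t : ℝ) :
    Li ![k] t = ∑' d : ℕ, ((d : ℝ) + 1) ^ (-k) * t ^ (d + 1) := by
  rw [Li, ← singleEquiv.tsum_eq]
  refine tsum_congr fun d => ?_
  simp [LiTerm, singleEquiv, div_eq_mul_inv, mul_comm]

lemma desLi0_eq (t : ℝ) : desLi0 t =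
    ∑' d : ℕ, t ^ (d + 1) + Real.log t * ∑' d : ℕ, ((d : ℝ) + 1) * t ^ (d + 1) := by
  rw [desLi0, Li_depth_one, Li_depth_one]
  simp

/-- A coefficient that splits into a shorter-tuple part and a last-gap part sums to a product, the
gap being `p.2 + 1`. -/
lemma hasSum_snoc {c : IncTuple r → ℝ} (hc : Convergent c) {g : ℕ → ℝ}
    {c' : IncTuple (r + 1) → ℝ} (h : ∀ p, c' (snocEquiv r p) = c p.1 * g p.2) {t : ℝ}
    (ht : t ∈ Set.Ioo (0 : ℝ) 1) (hg : Summable fun d => g d * t ^ (d + 1)) :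
    HasSum (fun n => c' n * t ^ n.1 (Fin.last (r + 1)))
      (series c t * ∑' d, g d * t ^ (d + 1)) := by
  rw [← (snocEquiv r).hasSum_iff]
  refine ((hc t ht).hasSum.mul hg.hasSum
    (summable_mul_of_summable_norm (hc t ht).norm hg.norm)).congr_fun ?_
  intro p
  simp only [Function.comp_apply, h, snocEquiv_last, pow_add]
  ring

lemma polylogComb_of_last_eq_zero (q : ℕ) (k : Fin (r + 2) → ℤ) (hk : k (Fin.last (r + 1)) = 0)
    {t : ℝ} (ht : t ∈ Set.Ioo (0 : ℝ) 1) :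
    polylogComb q k t = polylogComb q (Fin.init k) t * ∑' d : ℕ, t ^ (d + 1) -
      q * (polylogComb (q - 1) (Fin.init k) t * ∑' d : ℕ, ((d : ℝ) + 1) * t ^ (d + 1)) := by
  have hg0 : Summable fun d : ℕ => (1 : ℝ) * t ^ (d + 1) :=
    (summable_succ_pow_mul_pow 0 ht).congr fun d => by simp
  have hg1 : Summable fun d : ℕ => ((d : ℝ) + 1) * t ^ (d + 1) :=
    (summable_succ_pow_mul_pow 1 ht).congr fun d => by push_cast; ring
  have h0 := hasSum_snoc (convergent_zCoeff q (Fin.init k)) (g := fun _ => 1)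
    (c' := fun n => zCoeff q (Fin.init k) (Fin.init n.1))
    (fun p => by simp only [init_snocEquiv, mul_one]) ht hg0
  have h1 := hasSum_snoc (convergent_zCoeff (q - 1) (Fin.init k)) (g := fun d => (d : ℝ) + 1)
    (c' := fun n => zCoeff (q - 1) (Fin.init k) (Fin.init n.1) *
      diffPrev n.1 (Fin.last (r + 1)))
    (fun p => by simp only [init_snocEquiv, diffPrev_snocEquiv]) ht hg1
  simp only [one_mul] at h0
  rw [polylogComb_eq_series q k ht, polylogComb_eq_series q (Fin.init k) ht,
    polylogComb_eq_series (q - 1) (Fin.init k) ht, ← (h0.sub (h1.mul_left (q : ℝ))).tsum_eq, series]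
  refine tsum_congr fun n => ?_
  rw [zCoeff_of_last_eq_zero q k n.1 hk]
  ring

lemma desSum_of_last_eq_zero (k : Fin (r + 2) → ℤ) (hk : k (Fin.last (r + 1)) = 0)
    {t : ℝ} (ht : t ∈ Set.Ioo (0 : ℝ) 1) : desSum k t = desLi0 t * desSum (Fin.init k) t := by
  set A := ∑' d : ℕ, t ^ (d + 1)
  set B := ∑' d : ℕ, ((d : ℝ) + 1) * t ^ (d + 1)
  -- The longer index has one more value of `q`, at which the shorter combination vanishes.
  have h1 : ∑ q ∈ Finset.range (r + 3),
      (-Real.log t) ^ q / (q.factorial : ℝ) * polylogComb q (Fin.init k) t =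
      desSum (Fin.init k) t := by
    rw [Finset.sum_range_succ, polylogComb_eq_zero (r + 2) _ (by omega) ht, mul_zero, add_zero]
    rfl
  have h2 : ∑ q ∈ Finset.range (r + 3),
      (-Real.log t) ^ q / (q.factorial : ℝ) * (q * polylogComb (q - 1) (Fin.init k) t) =
      -Real.log t * desSum (Fin.init k) t := by
    rw [Finset.sum_range_succ', desSum, Finset.mul_sum]
    simp only [Nat.cast_zero, zero_mul, mul_zero, add_zero]
    refine Finset.sum_congr rfl fun q _ => ?_
    rw [Nat.factorial_succ, Nat.add_sub_cancel]
    push_cast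
    have h1 : (q.factorial : ℝ) ≠ 0 := by exact_mod_cast q.factorial_ne_zero
    have h2 : (q : ℝ) + 1 ≠ 0 := by positivity
    rw [pow_succ]
    field_simp
  calc desSum k t = ∑ q ∈ Finset.range (r + 3),
        (A * ((-Real.log t) ^ q / (q.factorial : ℝ) * polylogComb q (Fin.init k) t) -
          B * ((-Real.log t) ^ q / (q.factorial : ℝ) *
            (q * polylogComb (q - 1) (Fin.init k) t))) := by
        refine Finset.sum_congr rfl fun q _ => ?_
        rw [polylogComb_of_last_eq_zero q k hk ht]
        ring
    _ = desLi0 t * desSum (Fin.init k) t := by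
        rw [Finset.sum_sub_distrib, ← Finset.mul_sum, ← Finset.mul_sum, h1, h2, desLi0_eq]
        ring

lemma desSum_depth_one (k : Fin 1 → ℤ) (hk : k 0 = 0) {t : ℝ} (ht : t ∈ Set.Ioo (0 : ℝ) 1) :
    desSum k t = desLi0 t := by
  have h0 : polylogComb 0 k t = ∑' d : ℕ, t ^ (d + 1) := by
    rw [polylogComb_eq_series 0 k ht, series, ← singleEquiv.tsum_eq]
    refine tsum_congr fun d => ?_
    rw [(zCoeff_depth_one k hk _).1, one_mul]
    rfl
  have h1 : polylogComb 1 k t = -∑' d : ℕ, ((d : ℝ) + 1) * t ^ (d + 1) := by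
    rw [polylogComb_eq_series 1 k ht, series, ← singleEquiv.tsum_eq, ← tsum_neg]
    refine tsum_congr fun d => ?_
    rw [(zCoeff_depth_one k hk _).2]
    simp only [singleEquiv, Equiv.coe_fn_mk]
    push_cast
    ring
  rw [desSum, Finset.sum_range_succ, Finset.sum_range_one, h0, h1, desLi0_eq]
  simp

/-- The product inside the outermost operator is `desSum` of the index with last entry reset to `0`;
`Jpow` then restores that entry, whatever its sign. -/
lemma desLi_eq_desSum (k : Fin (r + 1) → ℤ) : Set.EqOn (desLi k) (desSum k) (Set.Ioo 0 1) := by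
  have hk : lowerLast (lowerLast k (k (Fin.last r))) (-k (Fin.last r)) = k := by
    rw [lowerLast_lowerLast, add_neg_cancel, lowerLast_zero]
  have hk0 : lowerLast k (k (Fin.last r)) (Fin.last r) = 0 := by rw [lowerLast_last, sub_self]
  induction r with
  | zero =>
    have h := Jpow_eq_desSum (f := desLi0) (lowerLast k (k (Fin.last 0)))
      (fun t ht => (desSum_depth_one _ hk0 ht).symm) (k (Fin.last 0))
    rw [hk] at h
    exact h
  | succ r ih =>
    have h := Jpow_eq_desSum (f := fun t => desLi0 t * desLi (Fin.init k) t)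
      (lowerLast k (k (Fin.last (r + 1))))
      (fun t ht => by
        rw [desSum_of_last_eq_zero _ hk0 ht, init_lowerLast]
        beta_reduce
        rw [ih (Fin.init k) (by rw [lowerLast_lowerLast, add_neg_cancel, lowerLast_zero])
          (by rw [lowerLast_last, sub_self]) ht]) (k (Fin.last (r + 1)))
    rw [hk] at h
    exact h

lemma Z_eq_desSum (k : Fin (r + 1) → ℤ) {t : ℝ} (ht : t ∈ Set.Ioo (0 : ℝ) 1) :
    Z k t = desSum k t := by
  rw [Z, finsum_eq_sum_of_support_subset (s := Finset.range (r + 2))]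
  · exact Finset.sum_congr rfl fun q _ => by rw [Zq_eq_polylogComb q k ht]
  · intro q hq
    by_contra h
    refine hq ?_
    have hq : r + 1 < q := by simpa [Nat.succ_le_iff] using h
    beta_reduce
    rw [Zq_eq_polylogComb q k ht, polylogComb_eq_zero q k hq ht, mul_zero]

end

end DesLi

/-! ### The main theorem -/

theorem mainTheorem3 (r : ℕ) (k : Fin (r + 1) → ℤ) (t : ℝ) (ht : t ∈ Set.Ioo (0 : ℝ) 1) :
    -- the series and the operators `J`, `D` are applied where they are meaningful
    Summable (DesLi.LiTerm k t) ∧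
    IntervalIntegrable (fun z => DesLi.desLi k z / z) MeasureTheory.volume 0 t ∧
    DifferentiableAt ℝ (DesLi.desLi k) t ∧
    -- the sum over `q` defining `Z(k; t)` is finite
    (∀ q : ℕ, r + 1 < q → DesLi.Zq q k t = 0) ∧
    -- the equality
    DesLi.desLi k t = DesLi.Z k t ∧
    -- the explicit form of `Z_q(k; t)` and of the equality
    (∀ q : ℕ, q ≤ r + 1 → DesLi.Zq q k t = DesLi.polylogComb q k t) ∧
    DesLi.desLi k t =
      ∑ q ∈ Finset.range (r + 2),
        (-1 : ℝ) ^ q * (Real.log t ^ q / (q.factorial : ℝ)) * DesLi.polylogComb q k t := by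
  have h := DesLi.desLi_eq_desSum k
  refine ⟨DesLi.summable_LiTerm k ht, ?_, ?_, fun q hq => ?_, ?_, fun q _ => ?_, ?_⟩
  · refine (DesLi.intervalIntegrable_desSum_div k ht).congr fun z hz => ?_
    rw [Set.uIoc_of_le ht.1.le] at hz
    simp only [h ⟨hz.1, hz.2.trans_lt ht.2⟩]
  · exact ((DesLi.hasDerivAt_desSum k ht).congr_of_eventuallyEq
      (h.eventuallyEq_of_mem (isOpen_Ioo.mem_nhds ht))).differentiableAt
  · rw [DesLi.Zq_eq_polylogComb q k ht, DesLi.polylogComb_eq_zero q k hq ht]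
  · rw [h ht, DesLi.Z_eq_desSum k ht]
  · exact DesLi.Zq_eq_polylogComb q k ht
  · rw [h ht, DesLi.desSum]
    refine Finset.sum_congr rfl fun q _ => ?_
    rw [neg_pow]
    ring
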